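/- Let $K$ be an algebraic number field with ring of integers $\mathcal{O}_K$, and let $\mathcal{O}\subseteq\mathcal{O}_K$ be an order in $K$, that is, a subring of $\mathcal{O}_K$ with quotient field $K$. Put $\mathcal{O}\cdot\mathcal{O}_K^\times=\{a\varepsilon : a\in\mathcal{O},\ \varepsilon\in\mathcal{O}_K^\times\}$, and call a prime ideal $\mathfrak{p}$ of $\mathcal{O}$ inert in $\mathcal{O}_K$ if $\mathfrak{p}\mathcal{O}_K$ is a prime ideal of $\mathcal{O}_K$. Then $$\mathcal{O}\cdot\mathcal{O}_K^\times=\mathcal{O}_K$$ if and only if $|\operatorname{Pic}(\mathcal{O}_K)|=|\operatorname{Pic}(\mathcal{O})|$ and every prime ideal of $\mathcal{O}$ is inert in $\mathcal{O}_K$, where $\operatorname{Pic}$ denotes the Picard group. -/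

import Mathlib

open scoped NumberField Pointwise

/-- An order in a number field `K`: a subring of the ring of integers `𝓞 K` whose field of
fractions is `K`. -/
def IsOrderIn (K : Type*) [Field K] (O : Subring (𝓞 K)) : Prop :=
  IsFractionRing O K

/-- A prime ideal `p` of `R` is inert in the `R`-algebra `S` if its extension `p S` is again a
prime ideal. -/
def IsInertIn {R : Type*} [CommRing R] (S : Type*) [CommRing S] [Algebra R S]
    (p : Ideal R) : Prop :=
  (p.map (algebraMap R S)).IsPrime

open scoped nonZeroDivisors

/-! ### Prime ideals, finite quotients and invertibility -/

namespace Ideal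

variable {A B : Type*} [CommRing A] [CommRing B] [Algebra A B]

/-! Everything rests on the map I ↦ I𝓞_K from the class group of O to that of 𝓞_K. If all primes are
inert, every nonzero ideal of 𝓞_K is extended from an invertible ideal of O
(`exists_isUnit_coeIdeal_map_eq`), so the map is onto. Equal finite cardinalities make it injective.
Writing (b) = I𝓞_K with I invertible, injectivity gives I = (a), and b is associated to a ∈ O.
Conversely, let every b be associated to an element of O. A prime P over p is then generated by P ∩
O = p, so p is inert and the map is onto. For injectivity, if I𝓞_K is principal, a generator is
adjusted by a unit until it lies in I (`exists_eq_span_singleton_of_map_eq`). This is only an issue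
at the finitely many primes containing some d ≠ 0 with d𝓞_K ⊆ O. -/

theorem exists_notMem_forall_mem_of_isMaximal {S : Set (Ideal A)} (hS : S.Finite)
    (hmax : ∀ q ∈ S, q.IsMaximal) {p : Ideal A} (hp : p.IsPrime) :
    ∃ c ∉ p, ∀ q ∈ S, q ≠ p → c ∈ q := by
  classical
  have hle : ¬ (hS.toFinset.erase p).inf id ≤ p := by
    intro h
    obtain ⟨q, hq, hqp⟩ := (IsPrime.inf_le' hp).1 h
    rw [Finset.mem_erase, Set.Finite.mem_toFinset] at hq
    exact hq.1 ((hmax q hq.2).eq_of_le hp.ne_top hqp)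
  obtain ⟨c, hc, hcp⟩ := SetLike.not_le_iff_exists.1 hle
  refine ⟨c, hcp, fun q hq hne => ?_⟩
  exact (Finset.inf_le (f := id) (by simp [hq, hne]) : _ ≤ id q) hc

/-- Chinese remainder gluing: with c_p outside p but in every other member of S, the sum ∑ c_p x_p
is c_p x_p modulo pB, and c_p is invertible modulo p. -/
theorem exists_mem_forall_notMem_map {S : Set (Ideal A)} (hS : S.Finite)
    (hmax : ∀ q ∈ S, q.IsMaximal) (L : Submodule A B)
    (hL : ∀ p ∈ S, ∃ x ∈ L, x ∉ p.map (algebraMap A B)) :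
    ∃ x ∈ L, ∀ p ∈ S, x ∉ p.map (algebraMap A B) := by
  classical
  have hc : ∀ p : S, ∃ c ∉ p.1, ∀ q ∈ S, q ≠ p.1 → c ∈ q := fun p =>
    exists_notMem_forall_mem_of_isMaximal hS hmax (hmax p p.2).isPrime
  choose c hcp hcq using hc
  choose x hxL hxp using fun p : S => hL p p.2
  have := hS.fintype
  refine ⟨∑ p, c p • x p, L.sum_mem fun p _ => L.smul_mem _ (hxL p), fun p hp hmem => ?_⟩
  rw [← Finset.add_sum_erase _ _ (Finset.mem_univ (⟨p, hp⟩ : S))] at hmem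
  have hrest : ∑ q ∈ Finset.univ.erase (⟨p, hp⟩ : S), c q • x q ∈ p.map (algebraMap A B) := by
    refine Ideal.sum_mem _ fun q hq => ?_
    rw [Algebra.smul_def]
    refine Ideal.mul_mem_right _ _ (mem_map_of_mem _ (hcq q p hp fun h => ?_))
    exact (Finset.mem_erase.1 hq).1 (Subtype.ext h.symm)
  have hcx := (Ideal.add_mem_iff_left _ hrest).1 hmem
  obtain ⟨y, i, hi, hyi⟩ := (hmax p hp).exists_inv (hcp ⟨p, hp⟩)
  refine hxp ⟨p, hp⟩ ?_
  have h1 : x ⟨p, hp⟩ = algebraMap A B y * (c ⟨p, hp⟩ • x ⟨p, hp⟩)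
      + algebraMap A B i * x ⟨p, hp⟩ := by
    rw [Algebra.smul_def, ← mul_assoc, ← add_mul, ← map_mul, ← map_add, hyi, map_one, one_mul]
  rw [h1]
  exact Ideal.add_mem _ (Ideal.mul_mem_left _ _ hcx)
    (Ideal.mul_mem_right _ _ (mem_map_of_mem _ hi))

theorem finite_setOf_le_of_finite_quotient (I : Ideal A) [Finite (A ⧸ I)] :
    {J : Ideal A | I ≤ J}.Finite := by
  have : Finite (Ideal (A ⧸ I)) :=
    Finite.of_injective (fun J => (J : Set (A ⧸ I))) SetLike.coe_injective
  refine (Set.finite_range fun J : Ideal (A ⧸ I) => J.comap (Ideal.Quotient.mk I)).subset ?_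
  intro J hJ
  refine ⟨J.map (Ideal.Quotient.mk I), ?_⟩
  rw [Set.mem_ofPred_eq] at hJ
  simpa [Ideal.comap_map_of_surjective _ Ideal.Quotient.mk_surjective, ← RingHom.ker_eq_comap_bot]

theorem finite_setOf_isPrime_mem [IsDomain A] [Ring.HasFiniteQuotients A] {d : A} (hd : d ≠ 0) :
    {q : Ideal A | q.IsPrime ∧ d ∈ q}.Finite := by
  have : Finite (A ⧸ span {d}) :=
    Ring.HasFiniteQuotients.finiteQuotient (by simpa [span_singleton_eq_bot] using hd)
  refine (finite_setOf_le_of_finite_quotient (span {d})).subset fun q hq => ?_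
  simpa [span_singleton_le_iff_mem] using hq.2

theorem isMaximal_of_isPrime_of_mem [Ring.HasFiniteQuotients A] {q : Ideal A} (hq : q.IsPrime)
    {d : A} (hd : d ≠ 0) (hdq : d ∈ q) : q.IsMaximal :=
  Ring.HasFiniteQuotients.maximalOfPrime fun h => hd (by simpa [h] using hdq)

theorem isUnit_coeIdeal_of_mul_eq_span [IsDomain A] (K : Type*) [Field K] [Algebra A K]
    [IsFractionRing A K] {I J : Ideal A} {x : A} (hx : x ≠ 0) (h : I * J = span {x}) :
    IsUnit (I : FractionalIdeal A⁰ K) := by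
  refine isUnit_of_mul_isUnit_left (y := (J : FractionalIdeal A⁰ K)) ?_
  rw [← FractionalIdeal.coeIdeal_mul, h, FractionalIdeal.coeIdeal_span_singleton]
  refine IsUnit.of_mul_eq_one (FractionalIdeal.spanSingleton A⁰ (algebraMap A K x)⁻¹) ?_
  rw [FractionalIdeal.spanSingleton_mul_spanSingleton, mul_inv_cancel₀,
    FractionalIdeal.spanSingleton_one]
  simpa using hx

theorem map_comap_eq_of_isPrime_map [IsDomain A] [IsDedekindDomain B] [FaithfulSMul A B]
    [Algebra.IsIntegral A B]
    (hin : ∀ p : Ideal A, p.IsPrime → (p.map (algebraMap A B)).IsPrime)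
    {P : Ideal B} (hP : P.IsPrime) (hP0 : P ≠ ⊥) :
    (P.comap (algebraMap A B)).map (algebraMap A B) = P := by
  have hp0 : P.comap (algebraMap A B) ≠ ⊥ := Ideal.IsIntegral.comap_ne_bot A hP0
  have hmap := hin _ (hP.comap (algebraMap A B))
  refine (hmap.isMaximal ?_).eq_of_le hP.ne_top map_comap_le
  rwa [Ne, Ideal.map_eq_bot_iff_of_injective (FaithfulSMul.algebraMap_injective A B)]

end Ideal

theorem exists_isIdempotentElem_pow {M : Type*} [Monoid M] [Finite M] (x : M) :
    ∃ n ≠ 0, IsIdempotentElem (x ^ n) := by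
  obtain ⟨m, n, hmn, h⟩ : ∃ m n, m < n ∧ x ^ m = x ^ n := by
    obtain ⟨m, n, hne, h⟩ := Finite.exists_ne_map_eq_of_infinite fun n : ℕ => x ^ n
    rcases hne.lt_or_gt with h' | h'
    exacts [⟨m, n, h', h⟩, ⟨n, m, h', h.symm⟩]
  obtain ⟨k, rfl⟩ := Nat.exists_eq_add_of_lt hmn
  have hper : ∀ j i, m ≤ i → x ^ (i + j * (k + 1)) = x ^ i := by
    intro j
    induction j with
    | zero => simp
    | succ j ih =>
      intro i hi
      obtain ⟨t, rfl⟩ := Nat.exists_eq_add_of_le hi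
      rw [← ih (m + t) hi, show m + t + (j + 1) * (k + 1) = (m + k + 1) + (t + j * (k + 1)) by ring,
        pow_add, ← h, ← pow_add, add_assoc]
  -- The exponent is a nonzero multiple of the period k + 1 and at least m, where periodicity
  -- starts.
  refine ⟨(m + 1) * (k + 1), by positivity, ?_⟩
  rw [IsIdempotentElem, ← pow_add]
  exact hper (m + 1) _ (by nlinarith)

/-! ### Lifting ideals to invertible ideals when primes are inert -/

namespace Ideal

variable {A B : Type*} [CommRing A] [IsDomain A] [Ring.HasFiniteQuotients A]
  [CommRing B] [IsDedekindDomain B] [Algebra A B] [FaithfulSMul A B] [Algebra.IsIntegral A B]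

/-- The component at `p` of the artinian ring `A ⧸ (x)` is cut out by an idempotent. -/
theorem exists_mul_one_sub_mem_span {p : Ideal A} (hp : p.IsPrime) {x : A} (hx : x ≠ 0) :
    ∃ e ∉ p, e * (1 - e) ∈ span {x} ∧ ∀ q : Ideal A, q.IsPrime → x ∈ q → q ≠ p → e ∈ q := by
  have : Finite (A ⧸ span {x}) :=
    Ring.HasFiniteQuotients.finiteQuotient (by simpa [span_singleton_eq_bot] using hx)
  obtain ⟨s, hsp, hs⟩ := exists_notMem_forall_mem_of_isMaximal (finite_setOf_isPrime_mem hx)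
    (fun q hq => isMaximal_of_isPrime_of_mem hq.1 hx hq.2) hp
  obtain ⟨n, hn, hid⟩ := exists_isIdempotentElem_pow (Ideal.Quotient.mk (span {x}) s)
  refine ⟨s ^ n, fun h => hsp (hp.mem_of_pow_mem _ h), ?_, fun q hq hxq hne =>
    Ideal.pow_mem_of_mem _ (hs q ⟨hq, hxq⟩ hne) _ (Nat.pos_of_ne_zero hn)⟩
  rw [← Ideal.Quotient.eq_zero_iff_mem, map_mul, map_sub, map_pow, map_one, mul_sub, hid.eq]
  simp

/-- The contraction p need not be visibly invertible, so it is replaced by (x, 1 - e), where x ∈ p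
and e is idempotent modulo x, isolating p. Its product with (x, e) is (x). -/
theorem exists_isUnit_coeIdeal_map_eq_of_isPrime (K : Type*) [Field K] [Algebra A K]
    [IsFractionRing A K]
    (hin : ∀ p : Ideal A, p.IsPrime → (p.map (algebraMap A B)).IsPrime)
    {P : Ideal B} (hP : P.IsPrime) (hP0 : P ≠ ⊥) :
    ∃ I : Ideal A, IsUnit (I : FractionalIdeal A⁰ K) ∧ I.map (algebraMap A B) = P := by
  have hpP := map_comap_eq_of_isPrime_map hin hP hP0
  have hp : (P.comap (algebraMap A B)).IsPrime := hP.comap _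
  obtain ⟨x, hxp, hxP⟩ : ∃ x ∈ P.comap (algebraMap A B), algebraMap A B x ∉ P ^ 2 := by
    by_contra! h
    have hle : (P.comap (algebraMap A B)).map (algebraMap A B) ≤ P ^ 2 :=
      map_le_iff_le_comap.2 fun x hx => h x hx
    rw [hpP] at hle
    exact (Ideal.pow_right_strictAnti P hP0 hP.ne_top (by norm_num : 1 < 2)).not_ge
      (by simpa using hle)
  have hx : x ≠ 0 := by
    rintro rfl
    simp at hxP
  obtain ⟨e, hep, hemul, heq⟩ := exists_mul_one_sub_mem_span hp hx
  have hep' : 1 - e ∈ P.comap (algebraMap A B) :=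
    (hp.mem_or_mem ((span_singleton_le_iff_mem _).2 hxp hemul)).resolve_left hep
  have hprod : span {x, 1 - e} * span {x, e} = span {x} := by
    apply le_antisymm
    · rw [span_pair_mul_span_pair, span_le]
      rintro y (rfl | rfl | rfl | rfl)
      · exact Ideal.mul_mem_left _ _ (mem_span_singleton_self x)
      · exact Ideal.mul_mem_right _ _ (mem_span_singleton_self x)
      · exact Ideal.mul_mem_left _ _ (mem_span_singleton_self x)
      · rwa [mul_comm]
    · rw [span_singleton_le_iff_mem]
      have h1 : x * e + (1 - e) * x ∈ span {x, 1 - e} * span {x, e} := Ideal.add_mem _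
        (mul_mem_mul (subset_span (by simp)) (subset_span (by simp)))
        (mul_mem_mul (subset_span (by simp)) (subset_span (by simp)))
      rwa [show x * e + (1 - e) * x = x by ring] at h1
  refine ⟨span {x, 1 - e}, isUnit_coeIdeal_of_mul_eq_span K hx hprod, ?_⟩
  have hle : (span {x, 1 - e}).map (algebraMap A B) ≤ P := by
    rw [map_le_iff_le_comap, span_le]
    rintro y (rfl | rfl)
    exacts [hxp, hep']
  -- A prime Q containing the cofactor R would lie over p, hence equal P, forcing x ∈ P².
  obtain ⟨R, hR⟩ := Ideal.dvd_iff_le.2 hle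
  suffices R = ⊤ by rw [hR, this, Ideal.mul_top]
  by_contra hR1
  obtain ⟨Q, hQ, hRQ⟩ := exists_le_maximal R hR1
  have hJQ : span {x, 1 - e} ≤ Q.comap (algebraMap A B) := by
    rw [← map_le_iff_le_comap, hR]
    exact Ideal.mul_le_right.trans hRQ
  have hxQ : x ∈ Q.comap (algebraMap A B) := hJQ (subset_span (by simp))
  have hQp : Q.comap (algebraMap A B) = P.comap (algebraMap A B) := by
    by_contra hne
    have h1 := heq _ (hQ.isPrime.comap _) hxQ hne
    have h2 : 1 - e ∈ Q.comap (algebraMap A B) := hJQ (subset_span (by simp))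
    exact (hQ.isPrime.comap (algebraMap A B)).ne_top
      ((Ideal.eq_top_iff_one _).2 (by simpa using Ideal.add_mem _ h1 h2))
  have hQ0 : Q ≠ ⊥ := by
    rintro rfl
    exact hx (FaithfulSMul.algebraMap_injective A B (by simpa using hxQ))
  have hQP : Q = P := by rw [← map_comap_eq_of_isPrime_map hin hQ.isPrime hQ0, hQp, hpP]
  refine hxP ?_
  have h3 : algebraMap A B x ∈ P * R := hR ▸ mem_map_of_mem _ (subset_span (by simp))
  rw [sq]
  exact Ideal.mul_mono_right (hQP ▸ hRQ) h3

theorem exists_isUnit_coeIdeal_map_eq (K : Type*) [Field K] [Algebra A K]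
    [IsFractionRing A K]
    (hin : ∀ p : Ideal A, p.IsPrime → (p.map (algebraMap A B)).IsPrime)
    {J : Ideal B} (hJ : J ≠ ⊥) :
    ∃ I : Ideal A, IsUnit (I : FractionalIdeal A⁰ K) ∧ I.map (algebraMap A B) = J := by
  induction J using UniqueFactorizationMonoid.induction_on_prime with
  | h₁ => exact absurd rfl hJ
  | h₂ J hu =>
    rw [Ideal.isUnit_iff] at hu
    refine ⟨⊤, ?_, by rw [Ideal.map_top, hu]⟩
    rw [FractionalIdeal.coeIdeal_top]
    exact isUnit_one
  | h₃ J P hJ0 hP ih =>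
    obtain ⟨I, hI, rfl⟩ := ih hJ0
    obtain ⟨I', hI', rfl⟩ := exists_isUnit_coeIdeal_map_eq_of_isPrime K hin
      (Ideal.isPrime_of_prime hP) hP.ne_zero
    exact ⟨I' * I, by simpa using hI'.mul hI, Ideal.map_mul _ _ _⟩

end Ideal

/-! ### The extension map on class groups for inert primes -/

namespace ClassGroup

theorem extendedHom_mk_of_coeIdeal {A B : Type*} [CommRing A] [IsDomain A] [CommRing B]
    [IsDedekindDomain B] [Algebra A B] [Module.IsTorsionFree A B]
    {I : (FractionalIdeal A⁰ (FractionRing A))ˣ} {I' : Ideal A}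
    (hI : (I : FractionalIdeal A⁰ (FractionRing A)) = I') {J : (Ideal B)⁰}
    (hJ : I'.map (algebraMap A B) = J) :
    extendedHom A B (mk (FractionRing A) I) = mk0 J := by
  rw [extendedHom_mk, ← mk_mk0 (FractionRing B)]
  congr 1
  ext1
  rw [FractionalIdeal.coe_mk0, ← hJ,
    ← FractionalIdeal.extendedHom_coeIdeal_eq_map (K := FractionRing A), ← hI]
  rfl

variable {A B : Type*} [CommRing A] [IsDomain A] [Ring.HasFiniteQuotients A]
  [CommRing B] [IsDedekindDomain B] [Algebra A B] [Module.IsTorsionFree A B]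
  [Algebra.IsIntegral A B]

theorem extendedHom_surjective_of_isPrime_map
    (hin : ∀ p : Ideal A, p.IsPrime → (p.map (algebraMap A B)).IsPrime) :
    Function.Surjective (extendedHom A B) := by
  intro y
  obtain ⟨J, rfl⟩ := mk0_surjective y
  obtain ⟨I, hI, hIJ⟩ := Ideal.exists_isUnit_coeIdeal_map_eq (FractionRing A) hin
    (nonZeroDivisors.ne_zero J.2)
  exact ⟨mk (FractionRing A) hI.unit, extendedHom_mk_of_coeIdeal hI.unit_spec hIJ⟩

theorem exists_associated_algebraMap_of_injective
    (hin : ∀ p : Ideal A, p.IsPrime → (p.map (algebraMap A B)).IsPrime)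
    (hinj : Function.Injective (extendedHom A B)) (b : B) :
    ∃ a : A, Associated (algebraMap A B a) b := by
  by_cases hb : b = 0
  · exact ⟨0, by simp [hb]⟩
  have hspan : Ideal.span {b} ≠ ⊥ := by simpa [Ideal.span_singleton_eq_bot] using hb
  obtain ⟨I, hI, hIb⟩ := Ideal.exists_isUnit_coeIdeal_map_eq (FractionRing A) hin hspan
  have hmk : mk (FractionRing A) hI.unit = 1 := by
    apply hinj
    rw [map_one, extendedHom_mk_of_coeIdeal (J := ⟨_, mem_nonZeroDivisors_of_ne_zero hspan⟩)
      hI.unit_spec hIb, mk0_eq_one_iff]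
    exact ⟨b, rfl⟩
  obtain ⟨a, -, rfl⟩ := (mk_eq_one_of_coe_ideal (I := hI.unit) hI.unit_spec).1 hmk
  refine ⟨a, Ideal.span_singleton_eq_span_singleton.1 ?_⟩
  rw [← hIb, Ideal.map_span, Set.image_singleton]

end ClassGroup

/-! ### Ideals when every element of B is associated to one of A -/

namespace Ideal

variable {A B : Type*} [CommRing A] [CommRing B] [Algebra A B]

theorem isPrime_map_of_forall_associated [IsDomain B] [FaithfulSMul A B] [Algebra.IsIntegral A B]
    (h : ∀ b : B, ∃ a : A, Associated (algebraMap A B a) b) {p : Ideal A} (hp : p.IsPrime) :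
    (p.map (algebraMap A B)).IsPrime := by
  obtain ⟨P, -, hP, hPp⟩ := exists_ideal_over_prime_of_isIntegral p (⊥ : Ideal B) (by
    rw [← RingHom.ker_eq_comap_bot, (RingHom.injective_iff_ker_eq_bot _).1
      (FaithfulSMul.algebraMap_injective A B)]
    exact bot_le)
  suffices p.map (algebraMap A B) = P from this ▸ hP
  refine le_antisymm (map_le_iff_le_comap.2 hPp.ge) fun b hb => ?_
  obtain ⟨a, u, rfl⟩ := h b
  refine Ideal.mul_mem_right _ _ (mem_map_of_mem _ (hPp ▸ ?_))
  exact (mul_unit_mem_iff_mem _ u.isUnit).1 hb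

/-- Invertibility gives M = wI⁻¹ ⊆ A. Cancelling w in B shows MB = B, and integrality forces M = A.
-/
theorem eq_span_singleton_of_mem_of_map_eq [IsDomain A] [IsDomain B] [FaithfulSMul A B]
    [Algebra.IsIntegral A B]
    {K : Type*} [Field K] [Algebra A K] [IsFractionRing A K] {I : Ideal A}
    (hI : IsUnit (I : FractionalIdeal A⁰ K)) {w : A} (hw0 : w ≠ 0) (hw : w ∈ I)
    (hmap : I.map (algebraMap A B) = span {algebraMap A B w}) : I = span {w} := by
  obtain ⟨M, hM⟩ : ∃ M : Ideal A, I * M = span {w} := by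
    obtain ⟨u, hu⟩ := hI
    have hle : ((u⁻¹ : (FractionalIdeal A⁰ K)ˣ) : FractionalIdeal A⁰ K) *
        ((span {w} : Ideal A) : FractionalIdeal A⁰ K) ≤ 1 := by
      rw [← Units.inv_mul u, hu]
      exact mul_le_mul_right ((FractionalIdeal.coeIdeal_le_coeIdeal K).2
        ((span_singleton_le_iff_mem _).2 hw)) _
    obtain ⟨M, hM⟩ := FractionalIdeal.le_one_iff_exists_coeIdeal.1 hle
    refine ⟨M, FractionalIdeal.coeIdeal_injective (K := K) ?_⟩
    simp only [FractionalIdeal.coeIdeal_mul]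
    rw [hM, ← hu, Units.mul_inv_cancel_left]
  have hMtop : M.map (algebraMap A B) = ⊤ := by
    have h := congrArg (Ideal.map (algebraMap A B)) hM
    rw [Ideal.map_mul, hmap, map_span, Set.image_singleton] at h
    have hw1 : algebraMap A B w ≠ 0 := by
      simpa using hw0
    rw [← Ideal.span_singleton_mul_right_inj hw1, h, Ideal.mul_top]
  rw [Ideal.map_eq_top_iff _ (FaithfulSMul.algebraMap_injective A B)
    (algebraMap_isIntegral_iff.2 inferInstance)] at hMtop
  rw [← hM, hMtop, Ideal.mul_top]

theorem exists_eq_span_singleton_of_map_eq [IsDomain A] [Ring.HasFiniteQuotients A] [IsDomain B]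
    [FaithfulSMul A B] [Algebra.IsIntegral A B]
    {K : Type*} [Field K] [Algebra A K] [IsFractionRing A K]
    (h : ∀ b : B, ∃ a : A, Associated (algebraMap A B a) b)
    {d : A} (hd0 : d ≠ 0) (hd : ∀ b : B, ∃ a : A, algebraMap A B a = algebraMap A B d * b)
    {I : Ideal A} (hI : IsUnit (I : FractionalIdeal A⁰ K)) {b : B} (hb : b ≠ 0)
    (hmap : I.map (algebraMap A B) = span {b}) : ∃ w : A, I = span {w} := by
  obtain ⟨a, hab⟩ := h b
  rw [← span_singleton_eq_span_singleton.2 hab] at hmap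
  have ha0 : algebraMap A B a ≠ 0 := hab.ne_zero_iff.2 hb
  let N : Submodule A B := Submodule.map (Algebra.linearMap A B) I
  -- L = {x : ax ∈ I}. Were L inside pB, then IB = aB would lie in a·pB, giving 1 ∈ pB.
  let L : Submodule A B := N.comap (LinearMap.mulLeft A (algebraMap A B a))
  have hdN : ∀ y ∈ I.map (algebraMap A B), ∀ c : B, algebraMap A B d * (c * y) ∈ N := by
    intro y hy
    induction hy using Submodule.span_induction with
    | mem y hy =>
      obtain ⟨i, hi, rfl⟩ := hy
      intro c
      obtain ⟨t, ht⟩ := hd c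
      exact ⟨t * i, I.mul_mem_left t hi, by simp [ht, mul_assoc]⟩
    | zero => simp
    | add y z _ _ hy hz => exact fun c => by simpa [mul_add] using N.add_mem (hy c) (hz c)
    | smul b y _ hy => exact fun c => by simpa [mul_assoc] using hy (c * b)
  have hmax : ∀ q ∈ {q : Ideal A | q.IsPrime ∧ d ∈ q}, q.IsMaximal := fun q hq =>
    isMaximal_of_isPrime_of_mem hq.1 hd0 hq.2
  obtain ⟨x, hxL, hx⟩ := exists_mem_forall_notMem_map (finite_setOf_isPrime_mem hd0) hmax L (by
    intro p hp
    by_contra! hLp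
    have hle : I.map (algebraMap A B) ≤ span {algebraMap A B a} * p.map (algebraMap A B) := by
      rw [map_le_iff_le_comap]
      intro i hi
      have hia : algebraMap A B i ∈ span {algebraMap A B a} := hmap ▸ mem_map_of_mem _ hi
      obtain ⟨y, hy⟩ := mem_span_singleton.1 hia
      rw [mem_comap, hy]
      exact mul_mem_mul (mem_span_singleton_self _) (hLp y ⟨i, hi, hy⟩)
    rw [hmap, span_singleton_le_iff_mem, mem_span_singleton_mul] at hle
    obtain ⟨z, hz, hza⟩ := hle
    rw [mul_eq_left₀ ha0] at hza
    rw [hza, ← eq_top_iff_one, Ideal.map_eq_top_iff _ (FaithfulSMul.algebraMap_injective A B)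
      (algebraMap_isIntegral_iff.2 inferInstance)] at hz
    exact hp.1.ne_top hz)
  obtain ⟨t, u, rfl⟩ := h x
  have htw : algebraMap A B a * u * algebraMap A B t ∈ N := by
    have := hxL
    rwa [Submodule.mem_comap, LinearMap.mulLeft_apply, mul_left_comm, mul_comm] at this
  -- T = {s : aus ∈ I} contains d and t, but t avoids every prime containing d because x = tu avoids
  -- its extension. Hence 1 ∈ T, and au is the required element of I.
  let T : Ideal A := N.comap (LinearMap.toSpanSingleton A B (algebraMap A B a * u))
  have hTmem : ∀ s : A, s ∈ T ↔ algebraMap A B a * u * algebraMap A B s ∈ N := fun s => by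
    rw [Submodule.mem_comap, LinearMap.toSpanSingleton_apply, Algebra.smul_def, mul_comm]
  have hT : T = ⊤ := by
    by_contra hT
    obtain ⟨m, hm, hTm⟩ := exists_le_maximal T hT
    have hdT : d ∈ T := by
      rw [hTmem]
      have := hdN _ (hmap ▸ mem_span_singleton_self (algebraMap A B a)) u
      rwa [mul_comm, mul_comm (u : B)] at this
    exact hx m ⟨hm.isPrime, hTm hdT⟩
      (Ideal.mul_mem_right _ _ (mem_map_of_mem _ (hTm ((hTmem t).2 htw))))
  obtain ⟨w, hw, hwa⟩ := (hTmem 1).1 (hT ▸ Submodule.mem_top)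
  rw [map_one, mul_one, Algebra.linearMap_apply] at hwa
  have hass : Associated (algebraMap A B a) (algebraMap A B w) := ⟨u, hwa.symm⟩
  refine ⟨w, eq_span_singleton_of_mem_of_map_eq (B := B) hI ?_ hw ?_⟩
  · rintro rfl
    exact (hass.ne_zero_iff.1 ha0) (map_zero _)
  · rw [hmap, span_singleton_eq_span_singleton.2 hass]

end Ideal

/-! ### Injectivity on class groups -/

namespace ClassGroup

variable {A B : Type*} [CommRing A] [IsDomain A] [Ring.HasFiniteQuotients A]
  [CommRing B] [IsDedekindDomain B] [Algebra A B] [Module.IsTorsionFree A B]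
  [Algebra.IsIntegral A B]

theorem exists_mk_unit_coeIdeal_eq {R : Type*} [CommRing R] [IsDomain R] (c : ClassGroup R) :
    ∃ (I : Ideal R) (hI : IsUnit (I : FractionalIdeal R⁰ (FractionRing R))),
      mk (FractionRing R) hI.unit = c := by
  refine ClassGroup.induction (FractionRing R) (fun I => ?_) c
  have hI : IsUnit ((I : FractionalIdeal R⁰ (FractionRing R)).num :
    FractionalIdeal R⁰ (FractionRing R)) := FractionalIdeal.isUnit_num.2 I.isUnit
  refine ⟨_, hI, Eq.symm (mk_eq_mk.2 ⟨Units.mk0 (algebraMap R _ I.1.den)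
    (IsFractionRing.to_map_ne_zero_of_mem_nonZeroDivisors I.1.den.2), Units.ext ?_⟩)⟩
  rw [mul_comm, Units.val_mul, coe_toPrincipalIdeal, Units.val_mk0]
  exact FractionalIdeal.den_mul_self_eq_num' R⁰ (FractionRing R) I

theorem extendedHom_injective_of_forall_associated
    (h : ∀ b : B, ∃ a : A, Associated (algebraMap A B a) b)
    {d : A} (hd0 : d ≠ 0) (hd : ∀ b : B, ∃ a : A, algebraMap A B a = algebraMap A B d * b) :
    Function.Injective (extendedHom A B) := by
  rw [injective_iff_map_eq_one]
  intro c hc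
  obtain ⟨I, hI, rfl⟩ : ∃ (I : Ideal A) (hI : IsUnit (I : FractionalIdeal A⁰ (FractionRing A))),
      mk (FractionRing A) hI.unit = c := exists_mk_unit_coeIdeal_eq c
  have hI0 : I.map (algebraMap A B) ≠ ⊥ := by
    rw [Ne, Ideal.map_eq_bot_iff_of_injective (FaithfulSMul.algebraMap_injective A B)]
    rintro rfl
    simp at hI
  rw [extendedHom_mk_of_coeIdeal (J := ⟨_, mem_nonZeroDivisors_of_ne_zero hI0⟩) hI.unit_spec rfl,
    mk0_eq_one_iff] at hc
  obtain ⟨b, hb⟩ := hc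
  rw [Ideal.submodule_span_eq] at hb
  obtain ⟨w, hw⟩ := Ideal.exists_eq_span_singleton_of_map_eq h hd0 hd hI (b := b)
    (by rintro rfl; simp [hb] at hI0) hb
  refine (mk_eq_one_of_coe_ideal (I := hI.unit) hI.unit_spec).2 ⟨w, ?_, hw⟩
  rintro rfl
  simp [hw] at hI0

end ClassGroup

/-! ### Orders in number fields -/

/-- An order in a number field contains a nonzero multiple of the ring of integers. -/
theorem IsOrderIn.exists_forall_mul_mem {K : Type*} [Field K] [NumberField K]
    {O : Subring (𝓞 K)} (hO : IsOrderIn K O) :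
    ∃ d : O, d ≠ 0 ∧ ∀ b : 𝓞 K, (d : 𝓞 K) * b ∈ O := by
  have : IsFractionRing O K := hO
  obtain ⟨s, hs⟩ := (Module.Finite.fg_top : (⊤ : Submodule ℤ (𝓞 K)).FG)
  obtain ⟨d, hd⟩ := IsLocalization.exist_integer_multiples O⁰ s (fun b : 𝓞 K => (b : K))
  refine ⟨d, nonZeroDivisors.ne_zero d.2, fun b => ?_⟩
  have hb : b ∈ Submodule.span ℤ (s : Set (𝓞 K)) := hs ▸ Submodule.mem_top
  induction hb using Submodule.span_induction with
  | mem b hb =>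
    obtain ⟨t, ht⟩ := hd b hb
    have : (t : 𝓞 K) = (d : 𝓞 K) * b := by
      apply NumberField.RingOfIntegers.ext
      exact ht
    exact this ▸ t.2
  | zero => simp
  | add x y _ _ hx hy => simpa [mul_add] using O.add_mem hx hy
  | smul n x _ hx => simpa [mul_left_comm] using O.zsmul_mem hx n

theorem lemma4p2 (K : Type*) [Field K] [NumberField K]
    (O : Subring (𝓞 K)) (hO : IsOrderIn K O) :
    (O : Set (𝓞 K)) * {ε : 𝓞 K | IsUnit ε} = Set.univ ↔
      Nat.card (CommRing.Pic (𝓞 K)) = Nat.card (CommRing.Pic O) ∧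
        ∀ p : Ideal O, p.IsPrime → IsInertIn (𝓞 K) p := by
  have : Module.Finite ℤ O :=
    Module.Finite.of_injective O.subtype.toAddMonoidHom.toIntLinearMap Subtype.val_injective
  have : FaithfulSMul O (𝓞 K) :=
    (faithfulSMul_iff_algebraMap_injective _ _).2 Subtype.val_injective
  have : Algebra.IsIntegral O (𝓞 K) :=
    ⟨fun x => (Algebra.IsIntegral.isIntegral (R := ℤ) x).tower_top⟩
  have hassoc : (O : Set (𝓞 K)) * {ε : 𝓞 K | IsUnit ε} = Set.univ ↔
      ∀ b : 𝓞 K, ∃ a : O, Associated (algebraMap O (𝓞 K) a) b := by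
    rw [Set.eq_univ_iff_forall]
    refine forall_congr' fun b => ⟨?_, ?_⟩
    · rintro ⟨a, ha, _, ⟨u, rfl⟩, h⟩
      exact ⟨⟨a, ha⟩, u, h⟩
    · rintro ⟨a, u, h⟩
      exact ⟨a, a.2, u, u.isUnit, h⟩
  rw [hassoc, ← Nat.card_congr (ClassGroup.equivPic (𝓞 K)).toEquiv,
    ← Nat.card_congr (ClassGroup.equivPic O).toEquiv]
  constructor
  · intro h
    have hin : ∀ p : Ideal O, p.IsPrime → (p.map (algebraMap O (𝓞 K))).IsPrime := fun p hp =>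
      Ideal.isPrime_map_of_forall_associated h hp
    obtain ⟨d, hd0, hd⟩ := hO.exists_forall_mul_mem
    refine ⟨(Nat.card_eq_of_bijective (ClassGroup.extendedHom O (𝓞 K)) ⟨?_, ?_⟩).symm, hin⟩
    · exact ClassGroup.extendedHom_injective_of_forall_associated h hd0 fun b => ⟨⟨_, hd b⟩, rfl⟩
    · exact ClassGroup.extendedHom_surjective_of_isPrime_map hin
  · rintro ⟨hcard, hin⟩
    -- `Nat.card` is 0 on infinite types, so equality with the positive class number of K yields
    -- finiteness.
    have : Finite (ClassGroup O) := Nat.finite_of_card_ne_zero (hcard ▸ Nat.card_pos.ne')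
    exact ClassGroup.exists_associated_algebraMap_of_injective hin
      ((ClassGroup.extendedHom_surjective_of_isPrime_map hin).bijective_of_nat_card_le hcard.ge).1
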